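/- Let $\mathcal A$ be a commutative ring. Let $Y_n$ be the set of planar binary rooted trees with $n$ internal vertices and $V$ the tree with one internal vertex. For trees $s,t$ let $s/t$ ("$s$ over $t$") be the tree obtained by grafting the root of $s$ on the left-most leaf of $t$, and $s\backslash t$ ("$s$ under $t$") the tree obtained by grafting the root of $t$ on the right-most leaf of $s$. Let $G$ be the set of formal series $A=\sum_{n\ge 1}\sum_{t\in Y_n}A_t\,t$ with $A_t\in\mathcal A$ and $A_V=1$; it is a group, with unit $V$, under the composition $$A\circ B=\sum_{t}\ \sum_{s_1,\dots,s_{|t|}}A_t\,B_{s_1}\cdots B_{s_{|t|}}\ \mu_t(s_1,\dots,s_{|t|}),$$ where $t,s_1,\dots,s_{|t|}$ run over the trees with at least one internal vertex, $|t|$ is the number of internal vertices of $t$, and $\mu_t(s_1,\dots,s_{|t|})$ is the tree obtained by inserting the $s_i$ in the vertices of $t$; that is, recursively, if $t$ has left subtree $t^l$, right subtree $t^r$, and $s$ is inserted at its root, the result is $u/s\backslash v$, where $u$ and $v$ are the results of the insertions in $t^l$ and $t^r$ (the empty tree if $t^l$, resp. $t^r$, has no vertex). Let $c_n\in Y_n$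 be the left comb and $d_n\in Y_n$ the right comb, and let $C=\sum_{n\ge1}c_n$, $D=\sum_{n\ge1}d_n$ and $E=C\circ D^{-1}$ in $G$. Order $Y_n$ by the Tamari order, the reflexive transitive closure of the relation in which $t'$ is obtained from $t$ by replacing a local configuration $V/V$ by $V\backslash V$ (that is, a subtree $(a\vee b)\vee c$ by $a\vee(b\vee c)$, where $x\vee y$ is the tree whose root has left subtree $x$ and right subtree $y$), so that $c_n$ is the minimum, and let $\mu$ be its Möbius function. Then $$E=\sum_{n\ge 1}\sum_{t\in Y_n}\mu(c_n,t)\,t \qquad\text{and}\qquad D^{-1}=V+\sum_{n\ge 1}\sum_{t\in Y_n}\mu(c_{n+1},V\backslash t)\;V\backslash t .$$ -/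

import Mathlib

namespace TreeSeries

open BinaryTree

/-! ### Planar binary trees, grafting products, combs -/

/-- Planar binary rooted trees; `nil` is the root tree (no internal vertex), `node () l r` is the
grafting `l ∨ r` of two trees on a new root, and `numNodes` counts internal vertices. -/
abbrev PBT : Type := BinaryTree Unit

/-- The vertex tree: one internal vertex. -/
def vertex : PBT := node () nil nil

/-- `graftOver s t` grafts the root of `s` on the left-most leaf of `t`
(for trees with vertices possibly decorated by elements of `α`). -/
def graftOver {α : Type*} (s : BinaryTree α) : BinaryTree α → BinaryTree α
  | nil => s
  | node a l r => node a (graftOver s l) r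

/-- `graftUnder s t` grafts the root of `t` on the right-most leaf of `s`. -/
def graftUnder {α : Type*} : BinaryTree α → BinaryTree α → BinaryTree α
  | nil, t => t
  | node a l r, t => node a l (graftUnder r t)

/-- The left comb with `n` vertices. -/
def leftComb : ℕ → PBT
  | 0 => nil
  | n + 1 => node () (leftComb n) nil

/-- The right comb with `n` vertices. -/
def rightComb : ℕ → PBT
  | 0 => nil
  | n + 1 => node () nil (rightComb n)

/-- The undecorated tree underlying a decorated tree. -/
def shape {α : Type*} (τ : BinaryTree α) : PBT := τ.map fun _ => ()

/-- Insertion of trees in the vertices of a tree (the composition of the duplicial operad).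
A tree `t` together with one tree `s_v` for each vertex `v` of `t` is encoded as a tree `τ` of shape
`t` whose vertices are decorated by trees. If the root is decorated by `s`, the result is
`(insertion in the left subtree) over s under (insertion in the right subtree)`. -/
def insertion {α : Type*} : BinaryTree (BinaryTree α) → BinaryTree α
  | nil => nil
  | node s l r => graftOver (insertion l) (graftUnder s (insertion r))

/-- The product of `B s` over the decorations `s` of the vertices. -/
def weight {α R : Type*} [CommRing R] (B : α → R) : BinaryTree α → R
  | nil => 1
  | node s l r => weight B l * B s * weight B r

/-! ### Facts about insertion -/

section Facts

variable {α β R : Type*}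

theorem over_nil_left (t : BinaryTree α) : graftOver nil t = t := by
  induction t with
  | nil => rfl
  | node a l r ihl _ => simp [graftOver, ihl]

theorem under_nil_right (t : BinaryTree α) : graftUnder t nil = t := by
  induction t with
  | nil => rfl
  | node a l r _ ihr => simp [graftUnder, ihr]

theorem over_assoc (x y z : BinaryTree α) : graftOver (graftOver x y) z = graftOver x (graftOver y z) := by
  induction z with
  | nil => rfl
  | node a l r ihl _ => simp [graftOver, ihl]

theorem under_assoc (x y z : BinaryTree α) : graftUnder (graftUnder x y) z = graftUnder x (graftUnder y z) := by
  induction x with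
  | nil => rfl
  | node a l r _ ihr => simp [graftUnder, ihr]

theorem over_under (x y z : BinaryTree α) (h : y ≠ nil) :
    graftUnder (graftOver x y) z = graftOver x (graftUnder y z) := by
  cases y with
  | nil => exact absurd rfl h
  | node a l r => simp [graftOver, graftUnder]

theorem under_ne_nil {x : BinaryTree α} (y : BinaryTree α) (h : x ≠ nil) : graftUnder x y ≠ nil := by
  cases x with
  | nil => exact absurd rfl h
  | node a l r => simp [graftUnder]

theorem numNodes_over (x y : BinaryTree α) : (graftOver x y).numNodes = x.numNodes + y.numNodes := by
  induction y with
  | nil => simp [graftOver]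
  | node a l r ihl _ => simp [graftOver, ihl]; omega

theorem numNodes_under (x y : BinaryTree α) : (graftUnder x y).numNodes = x.numNodes + y.numNodes := by
  induction x with
  | nil => simp [graftUnder]
  | node a l r _ ihr => simp [graftUnder, ihr]; omega

theorem weight_over [CommRing R] (B : α → R) (x y : BinaryTree α) :
    weight B (graftOver x y) = weight B x * weight B y := by
  induction y with
  | nil => simp [graftOver, weight]
  | node a l r ihl _ => simp [graftOver, weight, ihl, mul_assoc]

theorem weight_under [CommRing R] (B : α → R) (x y : BinaryTree α) :
    weight B (graftUnder x y) = weight B x * weight B y := by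
  induction x with
  | nil => simp [graftUnder, weight]
  | node a l r _ ihr => simp [graftUnder, weight, ihr, mul_assoc]

theorem weight_insertion [CommRing R] (B : α → R) (θ : BinaryTree (BinaryTree α)) :
    weight B (insertion θ) = weight (weight B) θ := by
  induction θ with
  | nil => rfl
  | node s l r ihl ihr => simp [insertion, weight, weight_over, weight_under, ihl, ihr, mul_assoc]

/-- All decorations satisfy `p`. -/
def AllLabels (p : α → Prop) : BinaryTree α → Prop
  | nil => True
  | node s l r => AllLabels p l ∧ p s ∧ AllLabels p r

theorem allLabels_of_weight [CommRing R] {B : α → R} {p : α → Prop} (hp : ∀ a, B a ≠ 0 → p a) :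
    ∀ τ : BinaryTree α, weight B τ ≠ 0 → AllLabels p τ
  | nil, _ => trivial
  | node s l r, h => by
      have h1 : weight B l ≠ 0 := fun e => h (by simp [weight, e])
      have h2 : B s ≠ 0 := fun e => h (by simp [weight, e])
      have h3 : weight B r ≠ 0 := fun e => h (by simp [weight, e])
      exact ⟨allLabels_of_weight hp l h1, hp s h2, allLabels_of_weight hp r h3⟩

theorem insertion_over (σ τ : BinaryTree (BinaryTree α)) :
    insertion (graftOver σ τ) = graftOver (insertion σ) (insertion τ) := by
  induction τ with
  | nil => rfl
  | node s l r ihl _ => simp [graftOver, insertion, ihl, over_assoc]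

theorem insertion_under (σ τ : BinaryTree (BinaryTree α)) (h : AllLabels (· ≠ nil) σ) :
    insertion (graftUnder σ τ) = graftUnder (insertion σ) (insertion τ) := by
  induction σ with
  | nil => rfl
  | node s l r _ ihr =>
    obtain ⟨_, hs, hr⟩ := h
    simp only [graftUnder, insertion, ihr hr]
    rw [over_under _ _ _ (under_ne_nil _ hs), under_assoc]

theorem insertion_insertion (θ : BinaryTree (BinaryTree (BinaryTree α)))
    (h : AllLabels (AllLabels (· ≠ nil)) θ) :
    insertion (θ.map insertion) = insertion (insertion θ) := by
  induction θ with
  | nil => rfl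
  | node s l r ihl ihr =>
    obtain ⟨hl, hs, hr⟩ := h
    simp only [BinaryTree.map, insertion, ihl hl, ihr hr, insertion_over, insertion_under _ _ hs]

/-- The total degree of a decorated tree. -/
def total (d : α → ℕ) : BinaryTree α → ℕ
  | nil => 0
  | node s l r => total d l + d s + total d r

theorem numNodes_insertion (τ : BinaryTree (BinaryTree α)) :
    (insertion τ).numNodes = total numNodes τ := by
  induction τ with
  | nil => rfl
  | node s l r ihl ihr => simp [insertion, total, numNodes_over, numNodes_under, ihl, ihr]; omega

theorem total_map (f : α → β) (d : β → ℕ) (τ : BinaryTree α) :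
    total d (τ.map f) = total (fun a => d (f a)) τ := by
  induction τ with
  | nil => rfl
  | node s l r ihl ihr => simp [BinaryTree.map, total, ihl, ihr]

theorem numNodes_le_total {d : α → ℕ} (τ : BinaryTree α) (h : AllLabels (fun a => 1 ≤ d a) τ) :
    τ.numNodes ≤ total d τ := by
  induction τ with
  | nil => simp
  | node s l r ihl ihr =>
    obtain ⟨hl, hs, hr⟩ := h
    have := ihl hl
    have := ihr hr
    simp only [numNodes, total]
    omega

theorem AllLabels.mono {p q : α → Prop} (h : ∀ a, p a → q a) :
    ∀ {τ : BinaryTree α}, AllLabels p τ → AllLabels q τ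
  | nil, _ => trivial
  | node _ _ _, ⟨hl, hs, hr⟩ => ⟨hl.mono h, h _ hs, hr.mono h⟩

/-- Finitely many decorated trees have bounded total degree, if the decorations have positive
degree and finitely many decorations have bounded degree. -/
theorem finite_total {d : α → ℕ} {p : α → Prop} (hp : ∀ a, p a → 1 ≤ d a)
    (hf : ∀ N, {a | p a ∧ d a ≤ N}.Finite) (N : ℕ) :
    {τ : BinaryTree α | AllLabels p τ ∧ total d τ ≤ N}.Finite := by
  induction N with
  | zero =>
    refine (Set.finite_singleton (nil : BinaryTree α)).subset ?_
    rintro (_ | ⟨s, l, r⟩) ⟨h, h'⟩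
    · rfl
    · have := hp _ h.2.1
      simp only [total] at h'
      omega
  | succ N ih =>
    refine ((Set.finite_singleton (nil : BinaryTree α)).union
      (((hf (N + 1)).prod (ih.prod ih)).image fun x => node x.1 x.2.1 x.2.2)).subset ?_
    rintro (_ | ⟨s, l, r⟩) ⟨⟨hl, hs, hr⟩, h'⟩
    · exact Or.inl rfl
    · right
      have := hp _ hs
      simp only [total] at h'
      exact ⟨(s, l, r), ⟨⟨hs, show d s ≤ N + 1 by omega⟩, ⟨hl, show total d l ≤ N by omega⟩,
        ⟨hr, show total d r ≤ N by omega⟩⟩, rfl⟩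

theorem finite_numNodes (N : ℕ) : {t : PBT | t.numNodes ≤ N}.Finite := by
  refine ((Set.finite_Iic N).biUnion fun n _ => (treesOfNumNodesEq n).finite_toSet).subset ?_
  intro t ht
  simp only [Set.mem_iUnion]
  exact ⟨t.numNodes, ht, by simp⟩

theorem ne_nil_iff (t : BinaryTree α) : t ≠ nil ↔ 1 ≤ t.numNodes := by
  cases t <;> simp [numNodes]

/-- Only finitely many ways exist to obtain a given tree by insertion of nonempty trees. -/
theorem finite_insertion (u : PBT) :
    {τ : BinaryTree PBT | AllLabels (· ≠ nil) τ ∧ insertion τ = u}.Finite := by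
  refine (finite_total (α := PBT) (d := numNodes) (p := (· ≠ nil)) (fun a h => (ne_nil_iff a).1 h)
    (fun N => (finite_numNodes N).subset fun t h => h.2) u.numNodes).subset ?_
  rintro τ ⟨h, rfl⟩
  exact ⟨h, (numNodes_insertion τ).ge⟩

theorem finite_insertion₂ (u : PBT) :
    {θ : BinaryTree (BinaryTree PBT) | AllLabels (fun σ => σ ≠ nil ∧ AllLabels (· ≠ nil) σ) θ ∧
      insertion (insertion θ) = u}.Finite := by
  refine (finite_total (d := total numNodes)
    (p := fun σ : BinaryTree PBT => σ ≠ nil ∧ AllLabels (· ≠ nil) σ) ?_ ?_ u.numNodes).subset ?_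
  · rintro σ ⟨h, h'⟩
    exact ((ne_nil_iff σ).1 h).trans
      (numNodes_le_total σ (h'.mono fun a ha => (ne_nil_iff a).1 ha))
  · intro N
    exact (finite_total (α := PBT) (d := numNodes) (p := (· ≠ nil))
      (fun a h => (ne_nil_iff a).1 h)
      (fun N => (finite_numNodes N).subset fun t h => h.2) N).subset fun σ h => ⟨h.1.2, h.2⟩
  · rintro θ ⟨h, rfl⟩
    refine ⟨h, ?_⟩
    rw [← insertion_insertion θ (h.mono fun _ h => h.2), numNodes_insertion, total_map]
    simp only [numNodes_insertion, le_refl]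

theorem map_graftOver (f : α → β) (x y : BinaryTree α) :
    (graftOver x y).map f = graftOver (x.map f) (y.map f) := by
  induction y with
  | nil => rfl
  | node a l r ihl _ => simp [graftOver, BinaryTree.map, ihl]

theorem map_graftUnder (f : α → β) (x y : BinaryTree α) :
    (graftUnder x y).map f = graftUnder (x.map f) (y.map f) := by
  induction x with
  | nil => rfl
  | node a l r _ ihr => simp [graftUnder, BinaryTree.map, ihr]

theorem map_insertion (f : α → β) (θ : BinaryTree (BinaryTree α)) :
    (insertion θ).map f = insertion (θ.map (BinaryTree.map f)) := by
  induction θ with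
  | nil => rfl
  | node s l r ihl ihr =>
    simp [insertion, BinaryTree.map, map_graftOver, map_graftUnder, ihl, ihr]

/-! Decompositions lift uniquely along forgetting decorations. -/

theorem over_lift (f : α → β) (y : BinaryTree β) : ∀ (x : BinaryTree β) (τ : BinaryTree α),
    τ.map f = graftOver x y →
      ∃! p : BinaryTree α × BinaryTree α, graftOver p.1 p.2 = τ ∧ p.1.map f = x ∧ p.2.map f = y := by
  induction y with
  | nil =>
    intro x τ h
    refine ⟨(τ, nil), ⟨rfl, h, rfl⟩, ?_⟩
    rintro ⟨a, b⟩ ⟨h1, h2, h3⟩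
    cases b with
    | nil => simp only [graftOver] at h1; simp [h1]
    | node => simp [BinaryTree.map] at h3
  | node s l r ihl _ =>
    intro x τ h
    cases τ with
    | nil => simp [BinaryTree.map, graftOver] at h
    | node s' l' r' =>
      simp only [BinaryTree.map, graftOver, node.injEq] at h
      obtain ⟨⟨a, b⟩, ⟨h1, h2, h3⟩, hu⟩ := ihl x l' h.2.1
      refine ⟨(a, node s' b r'), ⟨by simpa [graftOver] using h1, h2, by simp_all [BinaryTree.map]⟩, ?_⟩
      rintro ⟨a', b'⟩ ⟨g1, g2, g3⟩
      cases b' with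
      | nil => simp [BinaryTree.map] at g3
      | node s'' l'' r'' =>
        simp only [BinaryTree.map, graftOver, node.injEq] at g1 g3
        have := hu (a', l'') ⟨g1.2.1, g2, g3.2.1⟩
        simp only [Prod.mk.injEq] at this
        simp [this, g1.1, g1.2.2]

theorem under_lift (f : α → β) (x : BinaryTree β) : ∀ (y : BinaryTree β) (τ : BinaryTree α),
    τ.map f = graftUnder x y →
      ∃! p : BinaryTree α × BinaryTree α, graftUnder p.1 p.2 = τ ∧ p.1.map f = x ∧ p.2.map f = y := by
  induction x with
  | nil =>
    intro x τ h
    refine ⟨(nil, τ), ⟨rfl, rfl, h⟩, ?_⟩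
    rintro ⟨a, b⟩ ⟨h1, h2, h3⟩
    cases a with
    | nil => simp only [graftUnder] at h1; simp [h1]
    | node => simp [BinaryTree.map] at h2
  | node s l r _ ihr =>
    intro y τ h
    cases τ with
    | nil => simp [BinaryTree.map, graftUnder] at h
    | node s' l' r' =>
      simp only [BinaryTree.map, graftUnder, node.injEq] at h
      obtain ⟨⟨a, b⟩, ⟨h1, h2, h3⟩, hu⟩ := ihr y r' h.2.2
      refine ⟨(node s' l' a, b), ⟨by simpa [graftUnder] using h1, by simp_all [BinaryTree.map], h3⟩, ?_⟩
      rintro ⟨a', b'⟩ ⟨g1, g2, g3⟩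
      cases a' with
      | nil => simp [BinaryTree.map] at g2
      | node s'' l'' r'' =>
        simp only [BinaryTree.map, graftUnder, node.injEq] at g1 g2
        have := hu (r'', b') ⟨g1.2.2, g2.2.2, g3⟩
        simp only [Prod.mk.injEq] at this
        simp [this, g1.1, g1.2.1]

theorem insertion_lift (f : α → β) (σ : BinaryTree (BinaryTree β)) : ∀ τ : BinaryTree α,
    τ.map f = insertion σ →
      ∃! θ : BinaryTree (BinaryTree α), insertion θ = τ ∧ θ.map (BinaryTree.map f) = σ := by
  induction σ with
  | nil =>
    intro τ h
    cases τ with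
    | nil =>
      refine ⟨nil, ⟨rfl, rfl⟩, ?_⟩
      rintro (_ | _) ⟨_, h⟩
      · rfl
      · simp [BinaryTree.map] at h
    | node => simp [BinaryTree.map, insertion] at h
  | node s l r ihl ihr =>
    intro τ h
    obtain ⟨⟨a, b⟩, ⟨h1, h2, h3⟩, hu⟩ := over_lift f _ _ _ h
    obtain ⟨⟨c, d⟩, ⟨k1, k2, k3⟩, ku⟩ := under_lift f _ _ _ h3
    obtain ⟨l', ⟨m1, m2⟩, mu⟩ := ihl a h2
    obtain ⟨r', ⟨n1, n2⟩, nu⟩ := ihr d k3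
    refine ⟨node c l' r', ⟨by simp only [insertion]; rw [m1, n1, k1, h1],
      by simp only [BinaryTree.map]; rw [m2, n2, k2]⟩, ?_⟩
    rintro (_ | ⟨s'', l'', r''⟩) ⟨g1, g2⟩
    · simp [BinaryTree.map] at g2
    · simp only [BinaryTree.map, insertion, node.injEq] at g1 g2
      obtain ⟨e1, e2, e3⟩ := g2
      have mapu : (graftUnder s'' (insertion r'')).map f = graftUnder s (insertion r) := by
        rw [map_graftUnder, map_insertion, e1, e3]
      have q := hu (insertion l'', graftUnder s'' (insertion r''))
        ⟨g1, by rw [map_insertion, e2], mapu⟩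
      simp only [Prod.mk.injEq] at q
      have q' := ku (s'', insertion r'') ⟨q.2, e1, by rw [map_insertion, e3]⟩
      simp only [Prod.mk.injEq] at q'
      rw [mu l'' ⟨q.1, e2⟩, nu r'' ⟨q'.2, e3⟩, q'.1]

end Facts

/-! ### The group of tree-expanded formal diffeomorphisms -/

/-- Tree-expanded formal diffeomorphisms with coefficients in `R`: formal series
`∑ A_t t` over the trees `t` with at least one vertex (so the coefficient of `nil` is set to be
`0`), in which the vertex tree has coefficient `1`. -/
@[ext]
structure Diffeo (R : Type*) [CommRing R] where
  coeff : PBT → R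
  coeff_nil : coeff nil = 0
  coeff_vertex : coeff vertex = 1

/-- The coefficient of `u` in the composition `A ∘ B = ∑ A_t B_{s_1} ⋯ B_{s_n} μ_t(s_1, …, s_n)`,
where `t` ranges over trees with `n` vertices, `s_1, …, s_n` over trees, and `μ_t` is insertion in
the vertices of `t`. The data `(t, s_1, …, s_n)` are encoded as one decorated tree `τ`; as
`B nil = 0`, only finitely many terms are nonzero. -/
noncomputable def compCoeff {R : Type*} [CommRing R] (A B : PBT → R) (u : PBT) : R :=
  ∑ᶠ (τ : BinaryTree PBT) (_ : insertion τ = u), A (shape τ) * weight B τ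

section Composition

variable {R : Type*} [CommRing R]

theorem shape_map {α β : Type*} (f : α → β) (τ : BinaryTree α) : shape (τ.map f) = shape τ := by
  simp only [shape]
  rw [← BinaryTree.comp_map]

theorem numNodes_shape {α : Type*} (τ : BinaryTree α) : (shape τ).numNodes = τ.numNodes := by
  induction τ with
  | nil => rfl
  | node s l r ihl ihr => simp only [shape] at *; simp [BinaryTree.map, ihl, ihr]

theorem allLabels_of_weight_ne {B : PBT → R} (hB : B nil = 0) (τ : BinaryTree PBT)
    (h : weight B τ ≠ 0) : AllLabels (· ≠ nil) τ :=
  allLabels_of_weight (fun a ha (e : a = nil) => ha (by rw [e, hB])) τ h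

theorem finsum_fiber {X Y : Type*} (π : X → Y) (f : X → R) (hf : (Function.support f).Finite) :
    ∑ᶠ y, ∑ᶠ (x) (_ : π x = y), f x = ∑ᶠ x, f x := by
  classical
  have h1 : ∀ y, ∑ᶠ (x) (_ : π x = y), f x
      = ∑ x ∈ hf.toFinset, if π x = y then f x else 0 := by
    intro y
    simp only [finsum_eq_if]
    refine finsum_eq_sum_of_support_subset _ fun x hx => ?_
    simp only [Function.mem_support, ne_eq, ite_eq_right_iff, Classical.not_imp] at hx
    simpa using hx.2
  simp only [h1]
  rw [finsum_eq_sum_of_support_subset (s := hf.toFinset.image π), Finset.sum_comm,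
    finsum_eq_sum_of_support_subset (s := hf.toFinset)]
  · refine Finset.sum_congr rfl fun x hx => ?_
    rw [Finset.sum_ite_eq, if_pos (Finset.mem_image_of_mem π hx)]
  · simp
  · intro y hy
    by_contra hn
    refine hy (Finset.sum_eq_zero fun x hx => if_neg fun e => hn ?_)
    rw [← e]
    exact Finset.mem_coe.2 (Finset.mem_image_of_mem π hx)

theorem weight_eq_mul {α : Type*} (f g : α → R) (τ : BinaryTree α) :
    weight (fun a => f a * g a) τ = weight f τ * weight g τ := by
  induction τ with
  | nil => simp [weight]
  | node s l r ihl ihr => simp only [weight, ihl, ihr]; ring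

theorem weight_map {α β : Type*} (f : α → β) (B : β → R) (τ : BinaryTree α) :
    weight B (τ.map f) = weight (fun a => B (f a)) τ := by
  induction τ with
  | nil => rfl
  | node s l r ihl ihr => simp [BinaryTree.map, weight, ihl, ihr]

theorem finsum_mul_finsum {X Y : Type*} (S : Set X) (T : Set Y) (f : X → R) (g : Y → R)
    (hf : (S ∩ Function.support f).Finite) (hg : (T ∩ Function.support g).Finite) :
    (∑ᶠ x ∈ S, f x) * ∑ᶠ y ∈ T, g y = ∑ᶠ p ∈ S ×ˢ T, f p.1 * g p.2 := by
  classical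
  have hf' : (Function.support (S.indicator f)).Finite := by rwa [Set.support_indicator]
  have hg' : (Function.support (T.indicator g)).Finite := by rwa [Set.support_indicator]
  have e : ∀ p : X × Y, (S ×ˢ T).indicator (fun p => f p.1 * g p.2) p
      = S.indicator f p.1 * T.indicator g p.2 := by
    intro p
    simp only [Set.indicator_apply, Set.mem_prod]
    by_cases h1 : p.1 ∈ S <;> by_cases h2 : p.2 ∈ T <;> simp [h1, h2]
  simp only [finsum_mem_def, e]
  rw [finsum_curry, finsum_mul' (S.indicator f) _ hf']
  · exact finsum_congr fun x => mul_finsum' _ _ hg'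
  · refine (hf'.prod hg').subset ?_
    rintro ⟨x, y⟩ h
    exact ⟨left_ne_zero_of_mul h, right_ne_zero_of_mul h⟩

theorem mul_finsum_on {X : Type*} (S : Set X) (f : X → R) (c : R)
    (h : (S ∩ Function.support f).Finite) : c * ∑ᶠ x ∈ S, f x = ∑ᶠ x ∈ S, c * f x := by
  rw [← finsum_mem_inter_support f S, mul_finsum_mem' _ _ h]
  refine finsum_mem_inter_support_eq' _ _ _ fun x hx => ?_
  exact ⟨fun h => h.1, fun h => ⟨h, right_ne_zero_of_mul hx⟩⟩

/-- The weight of a decorated tree for a push-forward of coefficients. -/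
theorem weight_push {X Y : Type*} (π : X → Y) (g : X → R)
    (hf : ∀ y, {x | π x = y ∧ g x ≠ 0}.Finite) (τ : BinaryTree Y) :
    {θ : BinaryTree X | θ.map π = τ ∧ weight g θ ≠ 0}.Finite ∧
    weight (fun y => ∑ᶠ x ∈ {x | π x = y}, g x) τ
      = ∑ᶠ θ ∈ {θ : BinaryTree X | θ.map π = τ}, weight g θ := by
  induction τ with
  | nil =>
    have key : {θ : BinaryTree X | θ.map π = nil} = {nil} := by
      ext θ
      cases θ <;> simp [BinaryTree.map]
    refine ⟨(Set.finite_singleton nil).subset fun θ h => key ▸ h.1, ?_⟩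
    rw [key, finsum_mem_singleton]
    rfl
  | node s l r ihl ihr =>
    obtain ⟨fl, el⟩ := ihl
    obtain ⟨fr, er⟩ := ihr
    let nd : (BinaryTree X × X) × BinaryTree X → BinaryTree X := fun p => node p.1.2 p.1.1 p.2
    have bij : Set.BijOn nd (({θ | θ.map π = l} ×ˢ {x | π x = s}) ×ˢ {θ | θ.map π = r})
        {θ | θ.map π = node s l r} := by
      refine ⟨?_, ?_, ?_⟩
      · rintro ⟨⟨a, b⟩, c⟩ ⟨⟨h1, h2⟩, h3⟩
        simp only [Set.mem_ofPred_eq] at h1 h2 h3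
        simp [nd, BinaryTree.map, h1, h2, h3]
      · rintro ⟨⟨a, b⟩, c⟩ _ ⟨⟨a', b'⟩, c'⟩ _ h
        simp only [nd, node.injEq] at h
        simp [h]
      · rintro (_ | ⟨a, b, c⟩) h
        · simp [BinaryTree.map] at h
        · simp only [Set.mem_ofPred_eq, BinaryTree.map, node.injEq] at h
          exact ⟨((b, a), c), ⟨⟨h.2.1, h.1⟩, h.2.2⟩, rfl⟩
    constructor
    · refine (((fl.prod (hf s)).prod fr).image nd).subset ?_
      rintro θ ⟨h, hw⟩
      obtain ⟨⟨⟨a, b⟩, c⟩, ⟨⟨h1, h2⟩, h3⟩, rfl⟩ := bij.surjOn h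
      simp only [nd, weight] at hw
      exact ⟨_, ⟨⟨⟨h1, left_ne_zero_of_mul (left_ne_zero_of_mul hw)⟩,
        ⟨h2, right_ne_zero_of_mul (left_ne_zero_of_mul hw)⟩⟩,
        ⟨h3, right_ne_zero_of_mul hw⟩⟩, rfl⟩
    · simp only [weight, el, er]
      rw [finsum_mul_finsum {θ : BinaryTree X | θ.map π = l} {x | π x = s} _ _ fl (hf s),
        finsum_mul_finsum _ {θ : BinaryTree X | θ.map π = r} _ _ _ fr]
      · exact finsum_mem_eq_of_bijOn nd bij fun p _ => rfl
      · refine (fl.prod (hf s)).subset ?_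
        rintro ⟨a, b⟩ ⟨⟨h1, h2⟩, h⟩
        exact ⟨⟨h1, left_ne_zero_of_mul h⟩, ⟨h2, right_ne_zero_of_mul h⟩⟩

theorem finite_terms {B : PBT → R} (hB : B nil = 0) (A : PBT → R) (u : PBT) :
    {τ : BinaryTree PBT | insertion τ = u ∧ A (shape τ) * weight B τ ≠ 0}.Finite :=
  (finite_insertion u).subset fun τ h =>
    ⟨allLabels_of_weight_ne hB τ (right_ne_zero_of_mul h.2), h.1⟩

theorem compCoeff_assoc (A : PBT → R) {B C : PBT → R} (hB : B nil = 0) (hC : C nil = 0) :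
    compCoeff (compCoeff A B) C = compCoeff A (compCoeff B C) := by
  funext u
  let g : BinaryTree PBT → R := fun σ => B (shape σ) * weight C σ
  have hg : ∀ θ : BinaryTree (BinaryTree PBT), weight g θ ≠ 0 →
      AllLabels (fun σ => σ ≠ nil ∧ AllLabels (· ≠ nil) σ) θ := by
    refine allLabels_of_weight fun σ h => ⟨?_, allLabels_of_weight_ne hC σ (right_ne_zero_of_mul h)⟩
    rintro rfl
    exact left_ne_zero_of_mul h hB
  have hg' : ∀ θ : BinaryTree (BinaryTree PBT),
      weight g θ = weight B (θ.map shape) * weight C (insertion θ) := by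
    intro θ
    rw [weight_insertion, weight_map, ← weight_eq_mul]
  let f : BinaryTree (BinaryTree PBT) → R := fun θ =>
    ∑ᶠ _ : insertion (insertion θ) = u, A (shape θ) * weight g θ
  have hf : (Function.support f).Finite := by
    refine (finite_insertion₂ u).subset fun θ h => ?_
    by_cases e : insertion (insertion θ) = u
    · refine ⟨hg θ fun h0 => h ?_, e⟩
      simp [f, h0]
    · exact absurd (by simp [f, e]) h
  have left : compCoeff (compCoeff A B) C u = ∑ᶠ θ, f θ := by
    rw [← finsum_fiber insertion f hf]
    refine finsum_congr fun τ => ?_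
    by_cases e : insertion τ = u
    · have h1 : compCoeff A B (shape τ) =
          ∑ᶠ θ ∈ {θ | insertion θ = τ}, A (shape θ) * weight B (θ.map shape) := by
        refine (finsum_mem_eq_of_bijOn (BinaryTree.map shape) ⟨?_, ?_, ?_⟩ ?_).symm
        · rintro θ rfl
          exact (map_insertion _ θ).symm
        · rintro θ h θ' h' hh
          obtain ⟨θ₀, -, hu⟩ := insertion_lift (fun _ : PBT => ()) (θ.map shape) τ (by
            rw [← show insertion θ = τ from h]
            exact map_insertion _ θ)
          rw [hu θ ⟨h, rfl⟩, hu θ' ⟨h', hh.symm⟩]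
        · rintro σ h
          obtain ⟨θ₀, ⟨h1, h2⟩, -⟩ := insertion_lift (fun _ : PBT => ()) σ τ h.symm
          exact ⟨θ₀, h1, h2⟩
        · intro θ _
          simp only [shape_map]
      have fin : ({θ | insertion θ = τ} ∩ Function.support fun θ : BinaryTree (BinaryTree PBT) =>
          A (shape θ) * weight B (θ.map shape)).Finite := by
        refine Set.Finite.of_finite_image (f := BinaryTree.map shape)
          ((finite_terms hB A (shape τ)).subset ?_) ?_
        · rintro _ ⟨θ, ⟨h, h'⟩, rfl⟩
          refine ⟨?_, by rw [shape_map]; exact h'⟩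
          rw [← show insertion θ = τ from h]
          exact (map_insertion _ θ).symm
        · rintro θ ⟨h, -⟩ θ' ⟨h', -⟩ hh
          obtain ⟨θ₀, -, hu⟩ := insertion_lift (fun _ : PBT => ()) (θ.map shape) τ (by
            rw [← show insertion θ = τ from h]
            exact map_insertion _ θ)
          rw [hu θ ⟨h, rfl⟩, hu θ' ⟨h', hh.symm⟩]
      rw [finsum_eq_if, if_pos e, h1, mul_comm, mul_finsum_on _ _ _ fin]
      refine finsum_mem_congr rfl ?_
      rintro θ rfl
      simp only [f, e, finsum_true, hg']
      ring
    · rw [finsum_eq_if, if_neg e]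
      symm
      refine finsum_mem_eq_zero_of_forall_eq_zero (s := {θ | insertion θ = τ}) ?_
      rintro θ rfl
      simp [f, e]
  have right : compCoeff A (compCoeff B C) u = ∑ᶠ θ, f θ := by
    rw [← finsum_fiber (BinaryTree.map insertion) f hf]
    refine finsum_congr fun τ => ?_
    have hz : ∀ θ : BinaryTree (BinaryTree PBT), θ.map insertion = τ →
        f θ = ∑ᶠ _ : insertion τ = u, A (shape τ) * weight g θ := by
      rintro θ rfl
      by_cases h0 : weight g θ = 0
      · simp [f, h0]
      · rw [insertion_insertion θ ((hg θ h0).mono fun _ h => h.2), shape_map]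
    obtain ⟨fin, ew⟩ := weight_push insertion g (finite_terms hC B) τ
    refine Eq.trans ?_
      (finsum_mem_congr (s := {θ : BinaryTree (BinaryTree PBT) | θ.map insertion = τ}) rfl hz).symm
    by_cases e : insertion τ = u
    · simp only [e, finsum_true]
      rw [← mul_finsum_on {θ : BinaryTree (BinaryTree PBT) | θ.map insertion = τ} _ _ fin]
      exact congrArg _ ew
    · simp [e]
  rw [left, right]

theorem shape_eq_self (t : PBT) : shape t = t := BinaryTree.id_map t

theorem eq_nil_of_insertion {τ : BinaryTree PBT} (h : AllLabels (· ≠ nil) τ)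
    (h' : insertion τ = nil) : τ = nil := by
  have h1 := numNodes_le_total τ (h.mono fun a ha => (ne_nil_iff a).1 ha)
  rw [← numNodes_insertion, h'] at h1
  cases τ with
  | nil => rfl
  | node => simp at h1

/-- Insertion of the vertex tree everywhere. -/
theorem insertion_const (t : PBT) : insertion (t.map fun _ => vertex) = t := by
  induction t with
  | nil => rfl
  | node s l r ihl ihr =>
    simp only [BinaryTree.map, insertion, ihl, ihr]
    rfl

theorem eq_const_of_total {τ : BinaryTree PBT} (h : AllLabels (· ≠ nil) τ)
    (h' : total numNodes τ ≤ τ.numNodes) : τ = (shape τ).map fun _ => vertex := by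
  induction τ with
  | nil => rfl
  | node s l r ihl ihr =>
    obtain ⟨hl, hs, hr⟩ := h
    have h1 := numNodes_le_total l (hl.mono fun a ha => (ne_nil_iff a).1 ha)
    have h2 := numNodes_le_total r (hr.mono fun a ha => (ne_nil_iff a).1 ha)
    have h3 := (ne_nil_iff s).1 hs
    simp only [total, numNodes] at h'
    have e : s = vertex := by
      cases s with
      | nil => exact absurd rfl hs
      | node a x y =>
        have : x = nil := by
          by_contra hx
          have := (ne_nil_iff x).1 hx
          simp only [numNodes] at h'
          omega
        have : y = nil := by
          by_contra hy
          have := (ne_nil_iff y).1 hy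
          simp only [numNodes] at h'
          omega
        simp_all [vertex]
    have el := ihl hl (by omega)
    have er := ihr hr (by omega)
    simp only [shape, BinaryTree.map] at el er ⊢
    rw [← el, ← er, e]

theorem weight_const {B : PBT → R} (hB : B vertex = 1) (t : PBT) :
    weight B (t.map fun _ => vertex) = 1 := by
  induction t with
  | nil => rfl
  | node s l r ihl ihr => simp [BinaryTree.map, weight, ihl, ihr, hB]

theorem compCoeff_eq {B : PBT → R} (h0 : B nil = 0) (h1 : B vertex = 1) (A : PBT → R) (u : PBT) :
    compCoeff A B u = A u + ∑ᶠ τ ∈ {τ : BinaryTree PBT | insertion τ = u ∧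
      (shape τ).numNodes < u.numNodes}, A (shape τ) * weight B τ := by
  have e : ({τ : BinaryTree PBT | insertion τ = u} ∩
        Function.support fun τ => A (shape τ) * weight B τ) =
      (({u.map fun _ => vertex} ∪ {τ : BinaryTree PBT | insertion τ = u ∧
        (shape τ).numNodes < u.numNodes}) ∩
        Function.support fun τ => A (shape τ) * weight B τ) := by
    ext τ
    simp only [Set.mem_inter_iff, Set.mem_ofPred_eq, Set.mem_union, Set.mem_singleton_iff,
      and_congr_left_iff]
    intro hw
    have hl := allLabels_of_weight_ne h0 τ (right_ne_zero_of_mul hw)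
    constructor
    · rintro rfl
      rcases lt_or_ge (shape τ).numNodes (insertion τ).numNodes with h | h
      · exact Or.inr ⟨rfl, h⟩
      · rw [numNodes_insertion, numNodes_shape] at h
        left
        have := eq_const_of_total hl h
        have h2 := insertion_const (shape τ)
        rw [← this] at h2
        rw [h2]
        exact this
    · rintro (rfl | h)
      · exact insertion_const u
      · exact h.1
  change ∑ᶠ τ ∈ {τ : BinaryTree PBT | insertion τ = u}, A (shape τ) * weight B τ = _
  rw [finsum_mem_inter_support_eq _ _ _ e, finsum_mem_union', finsum_mem_singleton, shape_map,
    shape_eq_self, weight_const h1, mul_one]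
  · rw [Set.disjoint_singleton_left]
    rintro ⟨-, h⟩
    rw [shape_map, shape_eq_self] at h
    exact lt_irrefl _ h
  · exact (Set.finite_singleton _).inter_of_left _
  · exact (finite_terms h0 A u).subset fun τ h => ⟨h.1.1, h.2⟩

theorem compCoeff_nil {A B : PBT → R} (hA : A nil = 0) (h0 : B nil = 0) (h1 : B vertex = 1) :
    compCoeff A B nil = 0 := by
  rw [compCoeff_eq h0 h1, hA]
  simp

theorem compCoeff_vertex {A B : PBT → R} (hA : A nil = 0) (hA' : A vertex = 1) (h0 : B nil = 0)
    (h1 : B vertex = 1) : compCoeff A B vertex = 1 := by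
  rw [compCoeff_eq h0 h1, hA', finsum_mem_eq_zero_of_forall_eq_zero, add_zero]
  rintro τ ⟨-, h⟩
  have : shape τ = nil := by
    by_contra hn
    have := (ne_nil_iff _).1 hn
    simp only [vertex, numNodes] at h
    omega
  rw [this, hA, zero_mul]

/-- The series (family of coefficients) consisting of the single tree `t`. -/
noncomputable def monomial (R : Type*) [CommRing R] (t : PBT) : PBT → R := Pi.single t 1

theorem compCoeff_one (B : PBT → R) :
    compCoeff (monomial R vertex) B = B := by
  funext u
  change ∑ᶠ τ ∈ {τ : BinaryTree PBT | insertion τ = u}, _ = _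
  have key : ∀ τ : BinaryTree PBT, shape τ = vertex → ∃ s, τ = node s nil nil := by
    rintro (_ | ⟨s, _ | _, _ | _⟩) h <;> simp_all [shape, BinaryTree.map, vertex]
  have e : ({τ : BinaryTree PBT | insertion τ = u} ∩
        Function.support fun τ => monomial R vertex (shape τ) * weight B τ) =
      ({node u nil nil} ∩
        Function.support fun τ => monomial R vertex (shape τ) * weight B τ) := by
    ext τ
    simp only [Set.mem_inter_iff, Set.mem_ofPred_eq, Set.mem_singleton_iff, and_congr_left_iff]
    intro hw
    have hs : shape τ = vertex := by
      by_contra hn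
      exact left_ne_zero_of_mul hw (by simp [monomial, hn])
    obtain ⟨s, rfl⟩ := key τ hs
    simp [insertion, under_nil_right, over_nil_left]
  rw [finsum_mem_inter_support_eq _ _ _ e, finsum_mem_singleton]
  simp [monomial, shape, BinaryTree.map, vertex, weight]

/-- The left inverse for composition, by recursion on the number of vertices. -/
noncomputable def invCoeff (B : PBT → R) (u : PBT) : R :=
  monomial R vertex u - ∑ᶠ (τ : BinaryTree PBT) (_ : insertion τ = u ∧
    (shape τ).numNodes < u.numNodes), invCoeff B (shape τ) * weight B τ
termination_by u.numNodes
decreasing_by exact And.right ‹_›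

theorem compCoeff_inv {B : PBT → R} (h0 : B nil = 0) (h1 : B vertex = 1) :
    compCoeff (invCoeff B) B = monomial R vertex := by
  funext u
  rw [compCoeff_eq h0 h1, invCoeff]
  exact sub_add_cancel _ _

theorem invCoeff_nil (B : PBT → R) : invCoeff B nil = 0 := by
  rw [invCoeff]
  simp [monomial, vertex]

theorem invCoeff_vertex (B : PBT → R) : invCoeff B vertex = 1 := by
  rw [invCoeff, sub_eq_iff_eq_add]
  refine Eq.trans ?_ (congrArg _ (finsum_mem_eq_zero_of_forall_eq_zero (s := {τ : BinaryTree PBT |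
    insertion τ = vertex ∧ (shape τ).numNodes < numNodes vertex}) ?_).symm)
  · simp [monomial]
  · rintro τ ⟨-, h⟩
    have : shape τ = nil := by
      by_contra hn
      have := (ne_nil_iff _).1 hn
      simp only [vertex, numNodes] at h
      omega
    rw [this, invCoeff_nil, zero_mul]

end Composition

section Group

variable {R : Type*} [CommRing R]

/-- Composition of tree-expanded formal diffeomorphisms, written `A * B`. -/
noncomputable instance : Mul (Diffeo R) where
  mul A B := ⟨compCoeff A.coeff B.coeff, compCoeff_nil A.coeff_nil B.coeff_nil B.coeff_vertex,
    compCoeff_vertex A.coeff_nil A.coeff_vertex B.coeff_nil B.coeff_vertex⟩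

/-- The unit is the vertex tree. -/
noncomputable instance : One (Diffeo R) where
  one := ⟨monomial R vertex, by simp [monomial, vertex], by simp [monomial]⟩

noncomputable instance : Inv (Diffeo R) where
  inv B := ⟨invCoeff B.coeff, invCoeff_nil _, invCoeff_vertex _⟩

/-- The group of tree-expanded formal diffeomorphisms under composition. -/
noncomputable instance : Group (Diffeo R) :=
  Group.ofLeftAxioms
    (fun A B C => Diffeo.ext (compCoeff_assoc A.coeff B.coeff_nil C.coeff_nil))
    (fun B => Diffeo.ext (compCoeff_one B.coeff))
    (fun B => Diffeo.ext (compCoeff_inv B.coeff_nil B.coeff_vertex))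

end Group

open Classical in
/-- The sum of all left combs (with at least one vertex). -/
noncomputable def leftCombs (R : Type*) [CommRing R] : Diffeo R where
  coeff u := if ∃ n, 1 ≤ n ∧ u = leftComb n then 1 else 0
  coeff_nil := by
    refine if_neg ?_
    rintro ⟨_ | n, h, h'⟩
    · omega
    · simp [leftComb] at h'
  coeff_vertex := if_pos ⟨1, le_rfl, rfl⟩

open Classical in
/-- The sum of all right combs (with at least one vertex). -/
noncomputable def rightCombs (R : Type*) [CommRing R] : Diffeo R where
  coeff u := if ∃ n, 1 ≤ n ∧ u = rightComb n then 1 else 0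
  coeff_nil := by
    refine if_neg ?_
    rintro ⟨_ | n, h, h'⟩
    · omega
    · simp [rightComb] at h'
  coeff_vertex := if_pos ⟨1, le_rfl, rfl⟩

/-! ### Tamari posets -/

/-- The set of trees with `n` vertices. -/
@[ext]
structure Y (n : ℕ) where
  tree : PBT
  numNodes_eq : tree.numNodes = n
deriving DecidableEq

/-- One step: somewhere in the tree, a local configuration `(a ∨ b) ∨ c` (left comb with two
vertices) is replaced by `a ∨ (b ∨ c)` (right comb with two vertices). -/
inductive Rotation : PBT → PBT → Prop
  | root (a b c : PBT) : Rotation (node () (node () a b) c) (node () a (node () b c))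
  | left {l l' : PBT} (r : PBT) (h : Rotation l l') : Rotation (node () l r) (node () l' r)
  | right (l : PBT) {r r' : PBT} (h : Rotation r r') : Rotation (node () l r) (node () l r')

/-- The sum over all vertices of the size of the right subtree, which each step increases. -/
def rightSize : PBT → ℕ
  | nil => 0
  | node _ l r => rightSize l + rightSize r + r.numNodes

theorem Rotation.spec {s t : PBT} (h : Rotation s t) :
    s.numNodes = t.numNodes ∧ rightSize s < rightSize t := by
  induction h with
  | root a b c => simp only [numNodes, rightSize]; omega
  | left r _ ih => simp only [numNodes, rightSize]; omega
  | right l _ ih => simp only [numNodes, rightSize]; omega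

theorem eq_or_lt_of_reflTransGen {s t : PBT} (h : Relation.ReflTransGen Rotation s t) :
    s = t ∨ rightSize s < rightSize t := by
  induction h with
  | refl => exact Or.inl rfl
  | tail _ h ih =>
    right
    rcases ih with rfl | ih
    · exact h.spec.2
    · exact ih.trans h.spec.2

/-- The Tamari order on trees with `n` vertices: reflexive transitive closure of the steps. -/
instance (n : ℕ) : PartialOrder (Y n) where
  le s t := Relation.ReflTransGen Rotation s.tree t.tree
  le_refl _ := Relation.ReflTransGen.refl
  le_trans _ _ _ := Relation.ReflTransGen.trans
  le_antisymm s t h h' := by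
    ext
    rcases eq_or_lt_of_reflTransGen h with e | e
    · exact e
    · rcases eq_or_lt_of_reflTransGen h' with e' | e'
      · exact e'.symm
      · omega

instance (n : ℕ) : Fintype (Y n) :=
  Fintype.ofBijective (fun t : treesOfNumNodesEq n => (⟨t.1, mem_treesOfNumNodesEq.1 t.2⟩ : Y n))
    ⟨fun _ _ h => Subtype.ext (congrArg Y.tree h),
      fun t => ⟨⟨t.tree, mem_treesOfNumNodesEq.2 t.numNodes_eq⟩, rfl⟩⟩

open Classical in
noncomputable instance (n : ℕ) : LocallyFiniteOrder (Y n) := Fintype.toLocallyFiniteOrder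

/-- The left comb as an element of `Y n`. -/
def Y.leftComb (n : ℕ) : Y n :=
  ⟨TreeSeries.leftComb n, by
    induction n with
    | zero => rfl
    | succ n ih => simp [TreeSeries.leftComb, ih]⟩

/-- `V under t`, with `V` the vertex tree. -/
def Y.vertexUnder {n : ℕ} (t : Y n) : Y (n + 1) :=
  ⟨graftUnder vertex t.tree, by
    rw [numNodes_under, t.numNodes_eq]
    simp [vertex, add_comm]⟩

/-- The (integer valued) Möbius function of the Tamari poset on `Y n`. -/
noncomputable def moebius {n : ℕ} (s t : Y n) : ℤ := IncidenceAlgebra.mu ℤ s t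

end TreeSeries

/-! Both formulas reduce to one explicit sign function, `spineSign`.

Inverse of `D`. Inserting right combs in a right comb just concatenates them, so the terms of `D ∘ ∑
(-1)^(n-1) d_n` at `d_N` are the compositions of `N`, each signed by the parity of `N` minus its
number of parts. Splitting a first part `≥ 2` as 1 plus the rest, or merging a first part 1 with the
next one, changes the number of parts by one. So everything cancels except at `N = 1`, and `D⁻¹` is
the alternating sum (`splitFirst_spec`, `rightCombs_mul_altCombs`).

Coefficients of `E`. A tree is in a unique way a product `s_1 / ⋯ / s_k` of trees `s_i = V\r_i`, the
`r_i` being the right subtrees along its left-most branch. Only this decomposition contributes to `C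
∘ D⁻¹`, and it gives `spineSign`: a sign on products `d_{n_1} / ⋯ / d_{n_k}` of right combs, and 0
elsewhere (`eq_spine`, `leftCombs_mul_inv_coeff`).

Möbius function. The sums of `spineSign` over the intervals `[c_n, t]` must be 0 unless `t = c_n`.
The monotone map `rightWord` to Boolean words has `combOfWord` as a left adjoint on the words of
trees, and the images of `combOfWord` are exactly the products of right combs. The products below
`t` thus form the Boolean lattice of words below `rightWord t`, on which the sign is the parity of
the number of letters `true`. Its alternating sum vanishes unless that word is zero, that is, unless
`t` is the left comb (`sum_wordsBelow`, `sum_Icc_spineSign`). -/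

namespace TreeSeries

open BinaryTree

/-! ### Signed sums of right combs -/

section SignedCombs

variable (R : Type*) [CommRing R]

/-- `(-1) ^ n` on the right comb with `n` vertices, and `0` on the other trees. -/
def combSign : PBT → R
  | nil => 1
  | node _ nil r => -combSign r
  | node _ (node _ _ _) _ => 0

/-- The coefficients of `∑ (-1) ^ (n - 1) d_n`. -/
def altComb : PBT → R
  | nil => 0
  | node _ nil r => combSign R r
  | node _ (node _ _ _) _ => 0

/-- The product of `combSign` over the right subtrees of the vertices of the left-most branch. -/
def spineSign : PBT → R
  | nil => 1
  | node _ l r => spineSign l * combSign R r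

theorem intCast_combSign (t : PBT) : ((combSign ℤ t : ℤ) : R) = combSign R t := by
  fun_induction combSign ℤ t <;> simp_all [combSign]

theorem intCast_spineSign (t : PBT) : ((spineSign ℤ t : ℤ) : R) = spineSign R t := by
  induction t <;> simp_all [spineSign, intCast_combSign]

/-- The alternating sum of the right combs. -/
noncomputable def altCombs : Diffeo R where
  coeff := altComb R
  coeff_nil := rfl
  coeff_vertex := rfl

variable {R}

/-! ### Recursive description of combs and of their series -/

theorem eq_rightComb_iff (l r : PBT) :
    (∃ n, 1 ≤ n ∧ node () l r = rightComb n) ↔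
      l = nil ∧ (r = nil ∨ ∃ n, 1 ≤ n ∧ r = rightComb n) := by
  constructor
  · rintro ⟨_ | _ | n, h, h'⟩
    · omega
    · simp_all [rightComb]
    · simp only [rightComb, node.injEq, true_and] at h'
      exact ⟨h'.1, Or.inr ⟨n + 1, by omega, h'.2⟩⟩
  · rintro ⟨rfl, rfl | ⟨n, -, rfl⟩⟩
    · exact ⟨1, le_rfl, rfl⟩
    · exact ⟨n + 1, by omega, rfl⟩

theorem eq_leftComb_iff (l r : PBT) :
    (∃ n, 1 ≤ n ∧ node () l r = leftComb n) ↔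
      r = nil ∧ (l = nil ∨ ∃ n, 1 ≤ n ∧ l = leftComb n) := by
  constructor
  · rintro ⟨_ | _ | n, h, h'⟩
    · omega
    · simp_all [leftComb]
    · simp only [leftComb, node.injEq, true_and] at h'
      exact ⟨h'.2, Or.inr ⟨n + 1, by omega, h'.1⟩⟩
  · rintro ⟨rfl, rfl | ⟨n, -, rfl⟩⟩
    · exact ⟨1, le_rfl, rfl⟩
    · exact ⟨n + 1, by omega, rfl⟩

/-- Lets the involution add or remove the root of a right comb at no cost. The empty tree is
excluded because the coefficient jumps from 0 at `nil` to 1 at `vertex`. -/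
theorem rightCombs_coeff_node_nil (r : PBT) (hr : r ≠ nil) :
    (rightCombs R).coeff (node () nil r) = (rightCombs R).coeff r := by
  have h : (∃ n, 1 ≤ n ∧ node () nil r = rightComb n) ↔ ∃ n, 1 ≤ n ∧ r = rightComb n := by
    simp only [eq_rightComb_iff, true_and, hr, false_or]
  classical
  exact if_congr h rfl rfl

theorem eq_nil_of_rightCombs_coeff_ne {l r : PBT}
    (h : (rightCombs R).coeff (node () l r) ≠ 0) : l = nil := by
  by_contra hl
  exact h (if_neg fun h' => hl ((eq_rightComb_iff l r).1 h').1)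

theorem leftCombs_coeff_node_nil (l : PBT) (hl : l ≠ nil) :
    (leftCombs R).coeff (node () l nil) = (leftCombs R).coeff l := by
  have h : (∃ n, 1 ≤ n ∧ node () l nil = leftComb n) ↔ ∃ n, 1 ≤ n ∧ l = leftComb n := by
    simp only [eq_leftComb_iff, true_and, hl, false_or]
  classical
  exact if_congr h rfl rfl

theorem eq_nil_of_leftCombs_coeff_ne {l r : PBT}
    (h : (leftCombs R).coeff (node () l r) ≠ 0) : r = nil := by
  by_contra hr
  exact h (if_neg fun h' => hr ((eq_leftComb_iff l r).1 h').1)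

/-! ### The inverse of the series of right combs -/

theorem combSign_of_ne_nil {t : PBT} (h : t ≠ nil) : combSign R t = -altComb R t := by
  fun_cases combSign R t <;> simp_all [altComb]

theorem exists_of_altComb_ne {t : PBT} (h : altComb R t ≠ 0) :
    ∃ r, t = node () nil r ∧ combSign R r ≠ 0 := by
  rcases t with _ | ⟨⟨⟩, _ | ⟨⟨⟩, _, _⟩, r⟩
  · exact absurd rfl h
  · exact ⟨r, rfl, h⟩
  · exact absurd rfl h

theorem shape_node {α : Type*} (s : α) (l r : BinaryTree α) :
    shape (node s l r) = node () (shape l) (shape r) := rfl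

theorem shape_eq_nil {α : Type*} {τ : BinaryTree α} : shape τ = nil ↔ τ = nil := by
  cases τ <;> simp [shape, BinaryTree.map]

/-- Splits the first decoration `V\s` of a right comb into `V` and `s`, or conversely. -/
def splitFirst : BinaryTree PBT → BinaryTree PBT
  | node (node _ nil nil) nil (node s l r) => node (node () nil s) l r
  | node (node _ nil (node _ a b)) l r => node vertex nil (node (node () a b) l r)
  | τ => τ

/-- A nonzero term of the composition of `rightCombs` with `altCombs` is paired by `splitFirst`
with a term of opposite sign. -/
theorem splitFirst_spec {τ : BinaryTree PBT} (hτ : insertion τ ≠ vertex)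
    (h : (rightCombs R).coeff (shape τ) * weight (altComb R) τ ≠ 0) :
    insertion (splitFirst τ) = insertion τ ∧ splitFirst (splitFirst τ) = τ ∧ splitFirst τ ≠ τ ∧
    (rightCombs R).coeff (shape (splitFirst τ)) * weight (altComb R) (splitFirst τ)
      = -((rightCombs R).coeff (shape τ) * weight (altComb R) τ) := by
  rcases τ with _ | ⟨s, l, r⟩
  · exact absurd ((rightCombs R).coeff_nil) (left_ne_zero_of_mul h)
  have hl : l = nil := shape_eq_nil.1 (eq_nil_of_rightCombs_coeff_ne (left_ne_zero_of_mul h))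
  subst hl
  have hw := right_ne_zero_of_mul h
  simp only [weight, one_mul] at hw
  obtain ⟨s', rfl, hs'⟩ := exists_of_altComb_ne (left_ne_zero_of_mul hw)
  -- Either the first decoration is `V`, to be merged with the next one (which exists, since the
  -- insertion is not `vertex`), or it is `V\s'` with `s'` nonempty, to be split.
  rcases s' with _ | ⟨⟨⟩, a, b⟩
  · rcases r with _ | ⟨s₂, l₂, r₂⟩
    · exact absurd rfl hτ
    · have h2 := right_ne_zero_of_mul hw
      simp only [weight] at h2
      obtain ⟨s', rfl, -⟩ :=
        exists_of_altComb_ne (right_ne_zero_of_mul (left_ne_zero_of_mul h2))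
      have hc : (rightCombs R).coeff (shape (node vertex nil (node (node () nil s') l₂ r₂))) =
          (rightCombs R).coeff (shape (node (node () nil s') l₂ r₂)) :=
        rightCombs_coeff_node_nil _ (mt shape_eq_nil.1 (by simp))
      -- The shape is a right comb, so the second vertex has no left subtree. A nonempty one would
      -- be moved before the first vertex by the merge, which would change the insertion.
      have hl₂ : l₂ = nil := by
        rw [vertex] at hc
        have := left_ne_zero_of_mul h
        rw [hc] at this
        exact shape_eq_nil.1 (eq_nil_of_rightCombs_coeff_ne this)
      subst hl₂
      refine ⟨by simp [splitFirst, insertion, over_nil_left, graftUnder], rfl,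
        by simp [splitFirst], ?_⟩
      simp only [vertex] at hc
      rw [hc]
      simp only [splitFirst, weight, altComb, combSign, shape_node]
      ring
  · have hc := rightCombs_coeff_node_nil (R := R) (shape (node (node () a b) nil r))
      (mt shape_eq_nil.1 (by simp))
    refine ⟨by simp [splitFirst, insertion, over_nil_left, graftUnder, vertex], rfl,
      by simp [splitFirst, vertex], ?_⟩
    have e : shape (splitFirst (node (node () nil (node () a b)) nil r)) =
      node () nil (shape (node (node () a b) nil r)) := rfl
    rw [e, hc]
    have h1 : altComb R (node () nil (node () a b)) = -altComb R (node () a b) :=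
      combSign_of_ne_nil (by simp)
    have h2 : altComb R vertex = 1 := rfl
    simp only [splitFirst, weight, h1, h2, shape_node]
    ring

theorem rightCombs_mul_altCombs : rightCombs R * altCombs R = 1 := by
  classical
  ext u
  change compCoeff (rightCombs R).coeff (altComb R) u = monomial R vertex u
  -- The single vertex decorated by `V` is the only nonzero term without a partner.
  by_cases hu : u = vertex
  · subst hu
    rw [compCoeff_vertex (rightCombs R).coeff_nil (rightCombs R).coeff_vertex rfl rfl]
    simp [monomial]
  · have fin := finite_terms (R := R) (B := altComb R) rfl (rightCombs R).coeff u
    rw [monomial, Pi.single_eq_of_ne hu]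
    change ∑ᶠ τ ∈ {τ : BinaryTree PBT | insertion τ = u}, _ = _
    rw [finsum_mem_eq_sum_of_inter_support_eq (t := fin.toFinset)]
    · have key : ∀ τ ∈ fin.toFinset, _ := fun τ hτ =>
        splitFirst_spec (R := R) (τ := τ)
          (by rw [((Set.Finite.mem_toFinset _).1 hτ).1]; exact hu)
          ((Set.Finite.mem_toFinset _).1 hτ).2
      refine Finset.sum_involution (fun τ _ => splitFirst τ) ?_ ?_ ?_ ?_
      · intro τ hτ
        rw [(key τ hτ).2.2.2, add_neg_cancel]
      · intro τ hτ _
        exact (key τ hτ).2.2.1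
      · intro τ hτ
        have h := (Set.Finite.mem_toFinset _).1 hτ
        refine (Set.Finite.mem_toFinset _).2 ⟨(key τ hτ).1.trans h.1, ?_⟩
        rw [(key τ hτ).2.2.2]
        exact neg_ne_zero.2 h.2
      · intro τ hτ
        exact (key τ hτ).2.1
    · ext τ
      simp only [Set.mem_inter_iff, Function.mem_support, Set.Finite.coe_toFinset,
        Set.mem_ofPred_eq]
      tauto

theorem inv_rightCombs : (rightCombs R)⁻¹ = altCombs R :=
  inv_eq_of_mul_eq_one_right rightCombs_mul_altCombs

/-! ### The coefficients of `E` -/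

/-- The decomposition of a tree along its left-most branch. -/
def spine : PBT → BinaryTree PBT
  | nil => nil
  | node _ l r => node (node () nil r) (spine l) nil

theorem insertion_spine (u : PBT) : insertion (spine u) = u := by
  induction u with
  | nil => rfl
  | node a l r ihl _ => simp [spine, insertion, graftUnder, under_nil_right, graftOver, ihl]

theorem spine_ne_nil {u : PBT} (h : u ≠ nil) : spine u ≠ nil := by
  cases u <;> simp_all [spine]

theorem leftCombs_coeff_spine {u : PBT} (h : u ≠ nil) :
    (leftCombs R).coeff (shape (spine u)) = 1 := by
  induction u with
  | nil => exact absurd rfl h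
  | node a l r ihl _ =>
    by_cases hl : l = nil
    · subst hl
      exact (leftCombs R).coeff_vertex
    · rw [← ihl hl]
      exact leftCombs_coeff_node_nil _ (mt shape_eq_nil.1 (spine_ne_nil hl))

theorem weight_spine (u : PBT) : weight (altComb R) (spine u) = spineSign R u := by
  induction u with
  | nil => rfl
  | node a l r ihl _ => simp [spine, weight, spineSign, altComb, ihl]

/-- In a nonzero term the shape is a left comb and every decoration is some `V\r`. Insertion then
makes these `r` the right subtrees along the left-most branch, from which the decorations can be
read off. -/
theorem eq_spine {τ : BinaryTree PBT}
    (h : (leftCombs R).coeff (shape τ) * weight (altComb R) τ ≠ 0) :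
    τ = spine (insertion τ) := by
  induction τ with
  | nil => rfl
  | node s l r ihl _ =>
    have hr : r = nil := shape_eq_nil.1 (eq_nil_of_leftCombs_coeff_ne (left_ne_zero_of_mul h))
    subst hr
    have hw := right_ne_zero_of_mul h
    simp only [weight, mul_one] at hw
    obtain ⟨s', rfl, -⟩ := exists_of_altComb_ne (right_ne_zero_of_mul hw)
    simp only [insertion, under_nil_right, graftOver, spine]
    -- The coefficient of `leftCombs` at `nil` is 0, so the induction hypothesis says nothing about
    -- an empty left subtree.
    by_cases hl : l = nil
    · subst hl; rfl
    · rw [← ihl]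
      have e := leftCombs_coeff_node_nil (R := R) (shape l) (mt shape_eq_nil.1 hl)
      intro h0
      refine h ?_
      change (leftCombs R).coeff (node () (shape l) nil) * _ = 0
      rw [e]
      simp only [weight, mul_one, ← mul_assoc, h0, zero_mul]

theorem leftCombs_mul_inv_coeff {u : PBT} (hu : u ≠ nil) :
    (leftCombs R * (rightCombs R)⁻¹).coeff u = spineSign R u := by
  rw [inv_rightCombs]
  change ∑ᶠ τ ∈ {τ : BinaryTree PBT | insertion τ = u},
    (leftCombs R).coeff (shape τ) * weight (altComb R) τ = _
  rw [finsum_mem_inter_support_eq' _ _ {spine u}, finsum_mem_singleton,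
    leftCombs_coeff_spine hu, weight_spine, one_mul]
  intro τ hτ
  constructor
  · rintro rfl
    exact eq_spine hτ
  · rintro rfl
    exact insertion_spine u

end SignedCombs

/-! ### The Möbius function of the Tamari order from the left comb -/

section Tamari

/-- Records, for the vertices in infix order, whether the right subtree is nonempty. -/
def rightWord : PBT → List Bool
  | nil => []
  | node _ l r => rightWord l ++ decide (r ≠ nil) :: rightWord r

/-- Adds a vertex `v` before the first vertex of a tree (in infix order): over it if `b` is false,
and otherwise such that the first vertex becomes the right child of `v`. -/
def addFirst (b : Bool) : PBT → PBT
  | nil => vertex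
  | node _ nil r => if b then node () nil (node () nil r) else node () (node () nil nil) r
  | node _ (node _ a c) r => node () (addFirst b (node () a c)) r

/-- The tree `d_{n_1} / ⋯ / d_{n_k}` given by its word. -/
def combOfWord : List Bool → PBT
  | [] => nil
  | b :: w => addFirst b (combOfWord w)

local infix:50 " ≼ " => Relation.ReflTransGen Rotation

/-! ### Monotonicity of `rightWord` and of `combOfWord` -/

theorem node_le_node {l l' r r' : PBT} (hl : l ≼ l') (hr : r ≼ r') :
    node () l r ≼ node () l' r' :=
  (hl.lift (fun x => node () x r) fun _ _ => Rotation.left r).trans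
    (hr.lift (fun x => node () l' x) fun _ _ => Rotation.right l')

theorem Rotation.ne_nil {s t : PBT} (h : Rotation s t) : s ≠ nil ∧ t ≠ nil := by
  cases h <;> simp

theorem length_rightWord (t : PBT) : (rightWord t).length = t.numNodes := by
  induction t with
  | nil => rfl
  | node a l r ihl ihr => simp [rightWord, ihl, ihr]; omega

theorem forall₂_le_refl (w : List Bool) : List.Forall₂ (· ≤ ·) w w :=
  List.forall₂_refl w

theorem forall₂_le_trans {u v w : List Bool} (h : List.Forall₂ (· ≤ ·) u v)
    (h' : List.Forall₂ (· ≤ ·) v w) : List.Forall₂ (· ≤ ·) u w := by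
  induction h generalizing w with
  | nil => exact h'
  | cons h _ ih =>
    cases h' with
    | cons k ht => exact .cons (h.trans k) (ih ht)

/-- A rotation preserves the infix order of the vertices, and only the vertex between `a` and `b`
sees its letter change: its right subtree grows from `b` to `b ∨ c`. -/
theorem rightWord_mono_of_rotation {s t : PBT} (h : Rotation s t) :
    List.Forall₂ (· ≤ ·) (rightWord s) (rightWord t) := by
  induction h with
  | root a b c =>
    simp only [rightWord, List.append_assoc, List.cons_append]
    refine List.rel_append (forall₂_le_refl _) (.cons ?_ (forall₂_le_refl _))
    simp
  | left r h ih => exact List.rel_append ih (forall₂_le_refl _)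
  | right l h ih =>
    refine List.rel_append (forall₂_le_refl _) (.cons ?_ ih)
    simp [h.ne_nil.2]

theorem rightWord_mono {s t : PBT} (h : s ≼ t) :
    List.Forall₂ (· ≤ ·) (rightWord s) (rightWord t) := by
  induction h with
  | refl => exact forall₂_le_refl _
  | tail _ h ih => exact forall₂_le_trans ih (rightWord_mono_of_rotation h)

theorem addFirst_ne_nil (b : Bool) (t : PBT) : addFirst b t ≠ nil := by
  fun_cases addFirst b t <;> simp [vertex]

theorem addFirst_node {l : PBT} (b : Bool) (r : PBT) (hl : l ≠ nil) :
    addFirst b (node () l r) = node () (addFirst b l) r := by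
  cases l with
  | nil => exact absurd rfl hl
  | node => rfl

theorem addFirst_false (t : PBT) : addFirst false t = graftOver vertex t := by
  fun_induction addFirst false t <;> simp_all [graftOver, vertex]

/-- A rotation that moves the first vertex becomes two rotations when the new vertex sits above it
(`b = true`), hence the transitive closure in the conclusion. -/
theorem addFirst_mono_of_rotation (b : Bool) {s t : PBT} (h : Rotation s t) :
    addFirst b s ≼ addFirst b t := by
  induction h with
  | root a c d =>
    cases a with
    | nil =>
      cases b
      · exact .single (.root _ _ _)
      · exact .tail (.single (.root _ _ _)) (.right _ (.root _ _ _))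
    | node => exact .single (.root _ _ _)
  | left r h ih =>
    rw [addFirst_node _ _ h.ne_nil.1, addFirst_node _ _ h.ne_nil.2]
    exact node_le_node ih .refl
  | right l h ih =>
    cases l with
    | nil => cases b
             · exact .single (.right _ h)
             · exact .single (.right _ (.right _ h))
    | node => exact .single (.right _ h)

theorem addFirst_mono (b : Bool) {s t : PBT} (h : s ≼ t) : addFirst b s ≼ addFirst b t := by
  induction h with
  | refl => exact .refl
  | tail _ h ih => exact ih.trans (addFirst_mono_of_rotation b h)

theorem addFirst_false_le (b : Bool) (t : PBT) : addFirst false t ≼ addFirst b t := by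
  fun_induction addFirst b t with
  | case1 => exact .refl
  | case2 => rename_i h; subst h; exact .single (.root _ _ _)
  | case3 => rename_i h; simp only [Bool.not_eq_true] at h; subst h; exact .refl
  | case4 _ _ _ _ _ ih => exact node_le_node ih .refl

/-- Rotations move the new vertex up the left-most branch until it is the root. -/
theorem addFirst_true_le {t : PBT} (h : t ≠ nil) : addFirst true t ≼ node () nil t := by
  induction t with
  | nil => exact absurd rfl h
  | node _ l r ihl _ =>
    by_cases hl : l = nil
    · subst hl; exact .refl
    · rw [addFirst_node _ _ hl]
      exact (node_le_node (ihl hl) .refl).tail (.root _ _ _)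

theorem combOfWord_mono {w w' : List Bool} (h : List.Forall₂ (· ≤ ·) w w') :
    combOfWord w ≼ combOfWord w' := by
  induction h with
  | nil => exact .refl
  | @cons b b' w w' hb h ih =>
    refine .trans ?_ (addFirst_mono b' ih)
    cases b
    · exact addFirst_false_le b' _
    · cases b'
      · exact absurd hb (by decide)
      · exact .refl

theorem graftOver_le_graftOver {s t : PBT} (h : s ≼ t) (x : PBT) : graftOver s x ≼ graftOver t x := by
  induction x with
  | nil => exact h
  | node _ l r ihl _ => exact node_le_node ihl .refl

theorem rotation_graftOver (x : PBT) {s t : PBT} (h : Rotation s t) :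
    Rotation (graftOver x s) (graftOver x t) := by
  induction h with
  | root a b c => exact .root _ _ _
  | left r h ih => exact .left _ ih
  | right l h ih => exact .right _ h

/-! ### Products of right combs and the adjunction -/

theorem addFirst_graftOver (b : Bool) (x y : PBT) (h : x ≠ nil) :
    addFirst b (graftOver x y) = graftOver (addFirst b x) y := by
  induction y with
  | nil => rfl
  | node _ l r ihl _ =>
    simp only [graftOver]
    rw [addFirst_node, ihl]
    cases l <;> simp [graftOver, h]

theorem combOfWord_eq_nil {w : List Bool} : combOfWord w = nil ↔ w = [] := by
  cases w <;> simp [combOfWord, addFirst_ne_nil]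

/-- A letter `false` closes a run of `true`, hence a comb factor, so the product can be cut just
after it. -/
theorem combOfWord_append_false (u v : List Bool) :
    combOfWord (u ++ false :: v) = graftOver (combOfWord (u ++ [false])) (combOfWord v) := by
  induction u with
  | nil => exact addFirst_false _
  | cons b u ih =>
    simp only [List.cons_append, combOfWord]
    rw [ih, addFirst_graftOver]
    simp [combOfWord_eq_nil]

/-- The words of nonempty trees end with `false`. -/
theorem exists_rightWord_eq {t : PBT} (h : t ≠ nil) : ∃ u, rightWord t = u ++ [false] := by
  induction t with
  | nil => exact absurd rfl h
  | node _ l r _ ihr =>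
    by_cases hr : r = nil
    · subst hr
      exact ⟨rightWord l, by simp [rightWord]⟩
    · obtain ⟨u, hu⟩ := ihr hr
      exact ⟨rightWord l ++ decide (r ≠ nil) :: u, by simp [rightWord, hu]⟩

theorem combOfWord_rightWord_append (t : PBT) (v : List Bool) :
    combOfWord (rightWord t ++ v) = graftOver (combOfWord (rightWord t)) (combOfWord v) := by
  by_cases h : t = nil
  · subst h
    simp [rightWord, combOfWord, over_nil_left]
  · obtain ⟨u, hu⟩ := exists_rightWord_eq h
    rw [hu, List.append_assoc, List.singleton_append, combOfWord_append_false]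

/-- With `combOfWord_mono`, this is one half of the adjunction: a word below `rightWord t` gives a
tree below `t`. The inequality comes from `addFirst_true_le`, applied at each vertex with a nonempty
right subtree. -/
theorem combOfWord_rightWord_le (t : PBT) : combOfWord (rightWord t) ≼ t := by
  induction t with
  | nil => exact .refl
  | node _ l r ihl ihr =>
    rw [rightWord, combOfWord_rightWord_append]
    refine (graftOver_le_graftOver ihl _).trans ?_
    by_cases hr : r = nil
    · subst hr
      exact .refl
    · have h := (addFirst_mono true ihr).trans (addFirst_true_le hr)
      simp only [combOfWord, ne_eq, hr, not_false_eq_true, decide_true]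
      exact h.lift (graftOver l) fun _ _ => rotation_graftOver l

theorem combOfWord_cons_rightWord {r : PBT} (h : combSign ℤ r ≠ 0) :
    combOfWord (decide (r ≠ nil) :: rightWord r) = node () nil r := by
  induction r with
  | nil => rfl
  | node _ l r _ ihr =>
    cases l with
    | nil =>
      simp only [combSign, neg_ne_zero] at h
      have ih := ihr h
      simp only [combOfWord, rightWord, List.nil_append] at ih ⊢
      rw [ih]
      simp [addFirst]
    | node => exact absurd rfl h

/-- A nonzero sign forces every right subtree along the left-most branch to be a right comb, so the
tree is recovered from its word. In particular `rightWord` is injective on such trees. -/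
theorem combOfWord_rightWord {t : PBT} (h : spineSign ℤ t ≠ 0) :
    combOfWord (rightWord t) = t := by
  induction t with
  | nil => rfl
  | node _ l r ihl _ =>
    rw [rightWord, combOfWord_rightWord_append, ihl (left_ne_zero_of_mul h),
      combOfWord_cons_rightWord (right_ne_zero_of_mul h)]
    rfl

/-- The word is empty or its last letter is `false`. -/
def EndsFalse : List Bool → Prop
  | [] => True
  | b :: w => (b = true → w ≠ []) ∧ EndsFalse w

theorem endsFalse_append (u : List Bool) : EndsFalse (u ++ [false]) := by
  induction u with
  | nil => simp [EndsFalse]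
  | cons b u ih => exact ⟨by simp, ih⟩

theorem endsFalse_rightWord (t : PBT) : EndsFalse (rightWord t) := by
  by_cases h : t = nil
  · subst h; trivial
  · obtain ⟨u, hu⟩ := exists_rightWord_eq h
    rw [hu]
    exact endsFalse_append u

theorem EndsFalse.of_le {w v : List Bool} (hv : EndsFalse v) (h : List.Forall₂ (· ≤ ·) w v) :
    EndsFalse w := by
  induction h with
  | nil => trivial
  | @cons b b' w v hb h ih =>
    refine ⟨?_, ih hv.2⟩
    rintro rfl rfl
    cases h
    exact hv.1 (top_le_iff.1 hb) rfl

theorem rightWord_addFirst_false (t : PBT) : rightWord (addFirst false t) = false :: rightWord t := by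
  induction t with
  | nil => rfl
  | node _ l r ihl _ =>
    cases l with
    | nil => rfl
    | node => rw [addFirst_node _ _ (by simp), rightWord, ihl]; rfl

/-- On `nil` the letter would be lost, as a lone vertex has no right child; this is why `EndsFalse`
is needed below. -/
theorem rightWord_addFirst_true {t : PBT} (h : t ≠ nil) :
    rightWord (addFirst true t) = true :: rightWord t := by
  induction t with
  | nil => exact absurd rfl h
  | node _ l r ihl _ =>
    cases l with
    | nil => simp [addFirst, rightWord]
    | node => rw [addFirst_node _ _ (by simp), rightWord, ihl (by simp)]; rfl

theorem rightWord_combOfWord {w : List Bool} (h : EndsFalse w) : rightWord (combOfWord w) = w := by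
  induction w with
  | nil => rfl
  | cons b w ih =>
    cases b
    · rw [combOfWord, rightWord_addFirst_false, ih h.2]
    · rw [combOfWord, rightWord_addFirst_true (mt combOfWord_eq_nil.1 (h.1 rfl)), ih h.2]

theorem spineSign_addFirst_false (t : PBT) :
    spineSign ℤ (addFirst false t) = spineSign ℤ t := by
  induction t with
  | nil => rfl
  | node _ l r ihl _ =>
    cases l with
    | nil => simp [addFirst, spineSign, combSign]
    | node => rw [addFirst_node _ _ (by simp), spineSign, ihl]; rfl

/-- The letter `true` lengthens the first comb by one vertex, whereas `false` adds a factor `d_1`,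
of sign 1. -/
theorem spineSign_addFirst_true {t : PBT} (h : t ≠ nil) :
    spineSign ℤ (addFirst true t) = -spineSign ℤ t := by
  induction t with
  | nil => exact absurd rfl h
  | node _ l r ihl _ =>
    cases l with
    | nil => simp [addFirst, spineSign, combSign]
    | node => rw [addFirst_node _ _ (by simp), spineSign, ihl (by simp), neg_mul]; rfl

/-! ### Alternating sums over Boolean lattices and Tamari intervals -/

/-- The words that are letterwise at most a given word. -/
def wordsBelow : List Bool → Finset (List Bool)
  | [] => {[]}
  | false :: v => (wordsBelow v).image (List.cons false)
  | true :: v => (wordsBelow v).image (List.cons false) ∪ (wordsBelow v).image (List.cons true)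

theorem mem_wordsBelow {w v : List Bool} : w ∈ wordsBelow v ↔ List.Forall₂ (· ≤ ·) w v := by
  induction v generalizing w with
  | nil => simp [wordsBelow]
  | cons b v ih =>
    rcases w with _ | ⟨c, w⟩
    · cases b <;> simp [wordsBelow]
    · cases b <;> cases c <;> simp [wordsBelow, ih]

/-- If `v` starts with `true`, switching the first letter pairs the words below `v` with opposite
signs; if it starts with `false`, that letter can be dropped. -/
theorem sum_wordsBelow {v : List Bool} (hv : EndsFalse v) :
    ∑ w ∈ wordsBelow v, spineSign ℤ (combOfWord w) = if ∀ b ∈ v, b = false then 1 else 0 := by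
  induction v with
  | nil => rfl
  | cons b v ih =>
    have h0 : ∑ w ∈ (wordsBelow v).image (List.cons false), spineSign ℤ (combOfWord w) =
        ∑ w ∈ wordsBelow v, spineSign ℤ (combOfWord w) := by
      rw [Finset.sum_image fun _ _ _ _ h => (List.cons.inj h).2]
      exact Finset.sum_congr rfl fun w _ => spineSign_addFirst_false _
    cases b
    · rw [wordsBelow, h0, ih hv.2]
      simp
    · have h1 : ∑ w ∈ (wordsBelow v).image (List.cons true), spineSign ℤ (combOfWord w) =
          -∑ w ∈ wordsBelow v, spineSign ℤ (combOfWord w) := by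
        rw [Finset.sum_image fun _ _ _ _ h => (List.cons.inj h).2, ← Finset.sum_neg_distrib]
        -- `EndsFalse` makes `v`, hence `w`, nonempty, so prepending `true` does flip the sign.
        refine Finset.sum_congr rfl fun w hw => spineSign_addFirst_true fun h => hv.1 rfl ?_
        rw [combOfWord_eq_nil] at h
        subst h
        simpa using mem_wordsBelow.1 hw
      have hd : Disjoint ((wordsBelow v).image (List.cons false))
          ((wordsBelow v).image (List.cons true)) := by
        rw [Finset.disjoint_left]
        simp only [Finset.mem_image]
        rintro _ ⟨_, _, rfl⟩ ⟨_, _, h⟩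
        simp at h
      rw [wordsBelow, Finset.sum_union hd, h0, h1, add_neg_cancel]
      simp

theorem eq_leftComb_of_rightWord {t : PBT} (h : ∀ b ∈ rightWord t, b = false) :
    t = leftComb t.numNodes := by
  induction t with
  | nil => rfl
  | node _ l r ihl _ =>
    have hr : r = nil := by simpa using h (decide (r ≠ nil)) (by simp [rightWord])
    subst hr
    have := ihl fun b hb => h b (by simp [rightWord, hb])
    simp only [numNodes, leftComb, add_zero]
    rw [← this]

theorem rightWord_leftComb (n : ℕ) : rightWord (leftComb n) = List.replicate n false := by
  induction n with
  | zero => rfl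
  | succ n ih => simp [leftComb, rightWord, ih, List.replicate_succ']

theorem spineSign_leftComb (n : ℕ) : spineSign ℤ (leftComb n) = 1 := by
  induction n with
  | zero => rfl
  | succ n ih => simp [leftComb, spineSign, ih, combSign]

/-- The left comb is the image under `combOfWord` of the zero word, which is below every word. -/
theorem leftComb_le (t : PBT) : leftComb t.numNodes ≼ t := by
  refine .trans ?_ (combOfWord_rightWord_le t)
  rw [← combOfWord_rightWord (t := leftComb t.numNodes) (by simp [spineSign_leftComb])]
  refine combOfWord_mono ?_
  rw [rightWord_leftComb, ← length_rightWord]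
  induction rightWord t with
  | nil => exact .nil
  | cons b w ih => exact .cons (Bool.false_le b) ih

theorem Y.leftComb_le {n : ℕ} (t : Y n) : Y.leftComb n ≤ t := by
  obtain ⟨t, rfl⟩ := t
  exact TreeSeries.leftComb_le t

theorem sum_Icc_spineSign {n : ℕ} (t : Y n) :
    ∑ x ∈ Finset.Icc (Y.leftComb n) t, spineSign ℤ x.tree = if Y.leftComb n = t then 1 else 0 := by
  have key : (∀ b ∈ rightWord t.tree, b = false) ↔ Y.leftComb n = t := by
    constructor
    · intro h
      ext
      rw [eq_leftComb_of_rightWord h, t.numNodes_eq]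
      rfl
    · rintro rfl
      simp [Y.leftComb, rightWord_leftComb]
  -- Dropping the trees of sign 0 leaves products of right combs, which `rightWord` matches with the
  -- words below that of `t`.
  rw [← Finset.sum_filter_ne_zero, ← if_congr key rfl rfl,
    ← sum_wordsBelow (endsFalse_rightWord t.tree)]
  refine Finset.sum_of_injOn (fun x => rightWord x.tree) ?_ ?_ ?_ ?_
  · intro x hx y hy h
    simp only [Finset.coe_filter, Set.mem_ofPred_eq] at hx hy
    ext
    rw [← combOfWord_rightWord hx.2, ← combOfWord_rightWord hy.2]
    exact congrArg _ h
  · intro x hx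
    simp only [Finset.coe_filter, Finset.mem_Icc, Set.mem_ofPred_eq] at hx
    exact mem_wordsBelow.2 (rightWord_mono hx.1.2)
  -- By the adjunction, a word that contributes is the word of a tree in the interval.
  · intro w hw hn
    rw [mem_wordsBelow] at hw
    by_contra h0
    have e := rightWord_combOfWord ((endsFalse_rightWord _).of_le hw)
    have hN : (combOfWord w).numNodes = n := by
      rw [← length_rightWord, e, hw.length_eq, length_rightWord, t.numNodes_eq]
    refine hn ⟨⟨combOfWord w, hN⟩, ?_, e⟩
    simp only [Finset.coe_filter, Finset.mem_Icc, Set.mem_ofPred_eq]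
    exact ⟨⟨Y.leftComb_le _, (combOfWord_mono hw).trans (combOfWord_rightWord_le _)⟩, h0⟩
  · intro x hx
    rw [combOfWord_rightWord (Finset.mem_filter.1 hx).2]

/-- The values of the Möbius function from a given element are determined by their sums over
intervals. -/
theorem mu_eq_of_sum_Icc {α : Type*} [PartialOrder α] [LocallyFiniteOrder α] [DecidableEq α]
    {a : α} {f : α → ℤ} (h : ∀ b, a ≤ b → ∑ x ∈ Finset.Icc a b, f x = if a = b then 1 else 0)
    (b : α) (hab : a ≤ b) : IncidenceAlgebra.mu ℤ a b = f b := by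
  induction hc : (Finset.Icc a b).card using Nat.strong_induction_on generalizing b with
  | _ n ih =>
    subst hc
    have hb := h b hab
    by_cases e : a = b
    · subst e
      simpa using hb.symm
    · rw [if_neg e, Finset.Icc_eq_cons_Ico hab, Finset.sum_cons] at hb
      rw [IncidenceAlgebra.mu_eq_neg_sum_Ico_of_ne e, eq_neg_of_add_eq_zero_left hb]
      congr 1
      refine Finset.sum_congr rfl fun x hx => ?_
      obtain ⟨h1, h2⟩ := Finset.mem_Ico.1 hx
      refine ih _ (Finset.card_lt_card ?_) x h1 rfl
      exact Finset.Icc_ssubset_Icc_right hab le_rfl h2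

theorem moebius_leftComb {n : ℕ} (t : Y n) : moebius (Y.leftComb n) t = spineSign ℤ t.tree :=
  mu_eq_of_sum_Icc (f := fun x : Y n => spineSign ℤ x.tree) (fun b _ => sum_Icc_spineSign b) t
    t.leftComb_le

end Tamari

/-! ### Coefficients of double sums, and the theorem -/

section Expansion

variable {R : Type*} [CommRing R]

theorem monomial_apply_self (t : PBT) : monomial R t t = 1 := by simp [monomial]

theorem monomial_apply_of_ne {t u : PBT} (h : u ≠ t) : monomial R t u = 0 := by
  simp [monomial, h]

/-- A coefficient of a series written as a double sum over the degree and the trees. -/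
theorem finsum_sum_monomial (f : PBT → R) (u : PBT) :
    ∑ᶠ (n : ℕ) (_ : 1 ≤ n), ∑ t : Y n, f t.tree * monomial R t.tree u =
      if u = nil then 0 else f u := by
  have h : ∀ n, ∑ t : Y n, f t.tree * monomial R t.tree u = if u.numNodes = n then f u else 0 := by
    intro n
    split_ifs with hn
    · rw [Finset.sum_eq_single ⟨u, hn⟩]
      · simp [monomial_apply_self]
      · intro t _ ht
        rw [monomial_apply_of_ne, mul_zero]
        rintro rfl
        exact ht rfl
      · simp
    · refine Finset.sum_eq_zero fun t _ => ?_
      rw [monomial_apply_of_ne, mul_zero]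
      rintro rfl
      exact hn t.numNodes_eq
  simp only [h]
  rw [finsum_eq_single _ u.numNodes]
  -- The condition `1 ≤ n` fails precisely for `nil`, of degree 0.
  · cases u <;> simp
  · intro n hn
    simp [hn.symm]

end Expansion

end TreeSeries

theorem proposition3 (R : Type*) [CommRing R] :
    (TreeSeries.leftCombs R * (TreeSeries.rightCombs R)⁻¹).coeff
      = (fun u => ∑ᶠ (n : ℕ) (_ : 1 ≤ n), ∑ t : TreeSeries.Y n,
          (TreeSeries.moebius (TreeSeries.Y.leftComb n) t : R) *
            TreeSeries.monomial R t.tree u) ∧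
    (TreeSeries.rightCombs R)⁻¹.coeff
      = (fun u => TreeSeries.monomial R TreeSeries.vertex u +
          ∑ᶠ (n : ℕ) (_ : 1 ≤ n), ∑ t : TreeSeries.Y n,
            (TreeSeries.moebius (TreeSeries.Y.leftComb (n + 1)) t.vertexUnder : R) *
              TreeSeries.monomial R t.vertexUnder.tree u) := by
  open TreeSeries BinaryTree in
  simp only [moebius_leftComb, intCast_spineSign]
  constructor
  · funext u
    rw [finsum_sum_monomial (spineSign R)]
    split_ifs with hu
    · rw [hu, Diffeo.coeff_nil]
    · exact leftCombs_mul_inv_coeff hu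
  · have hV : ∀ {n} (t : Y n), t.vertexUnder.tree = node () nil t.tree := fun _ => rfl
    funext u
    simp only [hV]
    rw [inv_rightCombs]
    change altComb R u = _
    -- Only the trees `V\r` can carry a coefficient. For `r = nil` it comes from the separate term
    -- `V`, the sum starting at `n = 1`; otherwise it comes from the sum.
    rcases u with _ | ⟨⟨⟩, _ | ⟨⟨⟩, a, b⟩, r⟩
    · simp [monomial, vertex, altComb]
    · have h : ∀ t, monomial R (node () nil t) (node () nil r) = monomial R t r := by
        intro t
        simp [monomial, Pi.single_apply]
      have h1 : ∀ t, spineSign R (node () nil t) = combSign R t := fun t => one_mul _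
      simp only [vertex, h, h1]
      rw [finsum_sum_monomial (combSign R)]
      split_ifs with hr
      · subst hr
        simp [monomial, altComb, combSign]
      · rw [monomial_apply_of_ne hr, zero_add]
        rfl
    · simp [monomial, vertex, altComb]
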